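/- Let $q\ge 2$ and $-q<d\le 0$ be integers. A $(q,d)$-expansion of length $\ell$ is a word $x_{\ell-1}\dots x_0$ of $\ell$ digits $x_j\in\{d,\dots,q+d-1\}$. The carries of the standard addition of two such expansions $x,y$ are defined by $c_0=0$ and, for $0\le j<\ell$, $$c_{j+1}=\begin{cases}1&\text{if }x_j+y_j+c_j\ge q+d,\\-1&\text{if }x_j+y_j+c_j\le d-1,\\0&\text{otherwise.}\end{cases}$$ Let $M_\ell$ and $N_\ell$ be the numbers of indices $1\le j\le \ell$ with $c_j=1$ and with $c_j=-1$, respectively, when the two summands are independent and uniformly distributed on the set of all $q^\ell$ $(q,d)$-expansions of length $\ell$. Put \begin{align*} e_{1}&=\frac{(q+d-1)^2}{2(q-1)^2},\qquad e_{-1}=\frac{d^{2}}{2(q-1)^{2}},\\ v_{1}&=\frac{(q+d-1)^2(q^4-2q^3d-q^2d^2-4qd^2-2q^2-d^2+2d+1)}{4(q-1)^5(q+1)},\\ v_{-1}&=\frac{d^{2}(2q^4-q^2d^2-4q^3-6q^2d-4qd^2+4q^2+6qd-d^2-4q+2)}{4(q-1)^5(q+1)},\\ c&=-\frac{d(q+d-1)(q^3d+q^2d^2-q^3+3q^2d+4qd^2+2q^2-3qd+d^2-q-d)}{4(q-1)^5(q+1)}.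 \end{align*} Then, for fixed $q,d$ and $\ell\to\infty$: 1. $\mathbb E M_\ell=e_1\ell+O(1)$ and $\mathbb E N_\ell=e_{-1}\ell+O(1)$. 2. $\operatorname{Var}M_\ell=v_1\ell+O(1)$, $\operatorname{Var}N_\ell=v_{-1}\ell+O(1)$ and $\operatorname{Cov}(M_\ell,N_\ell)=c\,\ell+O(1)$. 3. If $d\ne 0$ and $d\ne -q+1$, then $M_\ell$ and $N_\ell$ are asymptotically jointly normally distributed: the matrix $\Sigma=\begin{pmatrix}v_1&c\\c&v_{-1}\end{pmatrix}$ is positive definite and $\bigl(\tfrac{M_\ell-e_1\ell}{\sqrt\ell},\tfrac{N_\ell-e_{-1}\ell}{\sqrt\ell}\bigr)$ converges in distribution to the bivariate normal distribution with mean $0$ and covariance matrix $\Sigma$. 4. If $d=0$, then $N_\ell=0$ for all $\ell$ (the carry $-1$ does not occur), $v_1>0$, and $(M_\ell-e_1\ell)/\sqrt\ell$ converges in distribution to the normal distribution with mean $0$ and variance $v_1$. If $d=-q+1$, then $M_\ell=0$ for all $\ell$, $v_{-1}>0$, and $(N_\ell-e_{-1}\ell)/\sqrt\ell$ converges in distribution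 to the normal distribution with mean $0$ and variance $v_{-1}$. -/

import Mathlib

open MeasureTheory ProbabilityTheory Filter Asymptotics

/-- A `(q,d)`-expansion of length `ℓ`: a word `x_{ℓ-1} … x_0` of `ℓ` digits, each in
`{d, …, q+d-1}`. The digit at position `j` (the coefficient of `q ^ j`) is `x j`. -/
abbrev QDExpansion (q d : ℤ) (ℓ : ℕ) : Type := Fin ℓ → Set.Icc d (q + d - 1)

namespace QDExpansion

/-- The digitwise sum `s_j = x_j + y_j` of two expansions, padded with zeros on the left. -/
def digitSum {q d : ℤ} {ℓ : ℕ} (x y : QDExpansion q d ℓ) (j : ℕ) : ℤ :=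
  if h : j < ℓ then (x ⟨j, h⟩ : ℤ) + (y ⟨j, h⟩ : ℤ) else 0

/-- The carries of the standard addition. The carry `c_0` into position `0` is `0`. At position
`j`, put `a = s_j + c_j`; the new carry `c_{j+1}` is `1` if `a ≥ q + d`, it is `-1` if
`a ≤ d - 1`, and `0` otherwise (so that the digit `a - q c_{j+1}` of the result is again in
`{d, …, q+d-1}`). -/
def carry (q d : ℤ) (s : ℕ → ℤ) : ℕ → ℤ
  | 0 => 0
  | j + 1 =>
    if q + d ≤ s j + carry q d s j then 1
    else if s j + carry q d s j ≤ d - 1 then -1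
    else 0

/-- The number of the carries `c_1, …, c_ℓ` equal to `k` when `x` and `y` are added. -/
def carryCount (q d : ℤ) {ℓ : ℕ} (k : ℤ) (x y : QDExpansion q d ℓ) : ℕ :=
  ((Finset.range ℓ).filter fun j => carry q d (digitSum x y) (j + 1) = k).card

/-- The constant `e_1`. -/
noncomputable def meanPos (q d : ℝ) : ℝ := (q + d - 1) ^ 2 / (2 * (q - 1) ^ 2)

/-- The constant `e_{-1}`. -/
noncomputable def meanNeg (q d : ℝ) : ℝ := d ^ 2 / (2 * (q - 1) ^ 2)

/-- The constant `v_1`. -/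
noncomputable def varPos (q d : ℝ) : ℝ :=
  (q + d - 1) ^ 2 * (q ^ 4 - 2 * q ^ 3 * d - q ^ 2 * d ^ 2 - 4 * q * d ^ 2 - 2 * q ^ 2 - d ^ 2
    + 2 * d + 1) / (4 * (q - 1) ^ 5 * (q + 1))

/-- The constant `v_{-1}`. -/
noncomputable def varNeg (q d : ℝ) : ℝ :=
  d ^ 2 * (2 * q ^ 4 - q ^ 2 * d ^ 2 - 4 * q ^ 3 - 6 * q ^ 2 * d - 4 * q * d ^ 2 + 4 * q ^ 2
    + 6 * q * d - d ^ 2 - 4 * q + 2) / (4 * (q - 1) ^ 5 * (q + 1))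

/-- The constant `c` of the covariance. -/
noncomputable def covConst (q d : ℝ) : ℝ :=
  -(d * (q + d - 1) * (q ^ 3 * d + q ^ 2 * d ^ 2 - q ^ 3 + 3 * q ^ 2 * d + 4 * q * d ^ 2
    + 2 * q ^ 2 - 3 * q * d + d ^ 2 - q - d)) / (4 * (q - 1) ^ 5 * (q + 1))

/-- The matrix with rows `(v_1, c)` and `(c, v_{-1})`. -/
noncomputable def covMat (q d : ℝ) : Matrix (Fin 2) (Fin 2) ℝ :=
  !![varPos q d, covConst q d; covConst q d, varNeg q d]

end QDExpansion

/-! The carries `c_0, c_1, …` form a Markov chain on `{1, -1, 0}`: each position contributes a fresh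
uniform digit pair, and counting lattice points in triangles gives transition probabilities that are
quadratic in the incoming carry (`sum_nextCarry`, `carryMean_succ`). Every function on three states
is a quadratic polynomial, and the transition operator `T` is triangular in the basis `1, c, c²`,
with diagonal `1, 1/q, 1/q²` (`transition_quad`). Poisson equations can therefore be solved in
closed form.

Fix real weights `α, β`, let `G` be the centred weight of a carry and `S` the sum of `G` over `c_1,
…, c_ℓ`; then `S` is the linear combination of the two centred counts with coefficients `α, β`
(`carryCount_linear`). Choose `h` with `T(G + h) = h`, and `κ` with `T(G²/2 + Gh + κ) = κ + v`,
where `2v` is the quadratic form of the claimed covariance matrix at `(α, β)`. The mean of `S +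
h(c_ℓ)` is then constant, and the mean of `S² + 2 S h(c_ℓ) + 2 κ(c_ℓ)` is exactly affine in `ℓ` with
slope `2v`. Since the means of `S`, `S h(c_ℓ)` and `κ(c_ℓ)` are bounded, the moment asymptotics
follow, and polarization gives the covariance.

For the limit law no spectral perturbation theory is needed. The function `1 + z h + z² κ` is an
eigenvector of the operator twisted by `exp(zG)`, with eigenvalue `1 + z² v`, up to `O(z³)`
(`isBigO_approxEigen`). With `z = i/√ℓ`, the `ℓ` accumulated errors are `O(ℓ^(-1/2))`, while `(1 -
v/ℓ)^ℓ → exp(-v)` (`tendsto_carryMean_exp`). As `α, β` are arbitrary, Lévy's theorem gives the joint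
limit. Positivity of the variances and of the determinant is a matter of polynomials with positive
coefficients in `-d` and `q + d - 1`. -/

namespace QDExpansion

/-! ### The carries as a Markov chain: transition counts and the one-step recursion. -/

section Combinatorics

variable {E : Type*} [AddCommGroup E] [Module ℝ E]

/-- The carry produced by the digit sum `s` and the incoming carry `c`. -/
def nextCarry (q d s c : ℤ) : ℤ :=
  if q + d ≤ s + c then 1 else if s + c ≤ d - 1 then -1 else 0

/-- The probability that an incoming carry `c` produces the carry `1`. -/
noncomputable def posProb (q d c : ℝ) : ℝ := (q + d + c) * (q + d + c - 1) / (2 * q ^ 2)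

/-- The probability that an incoming carry `c` produces the carry `-1`. -/
noncomputable def negProb (q d c : ℝ) : ℝ := (d + c) * (d + c - 1) / (2 * q ^ 2)

/-- The transition operator of the Markov chain of the carries. -/
noncomputable def transition (q d : ℝ) (f : ℤ → E) (c : ℤ) : E :=
  posProb q d c • f 1 + negProb q d c • f (-1) + (1 - posProb q d c - negProb q d c) • f 0

/-- The sum of `G` over the carries `c_1, …, c_ℓ`. -/
noncomputable def carrySum (q d : ℤ) (G : ℤ → ℝ) {ℓ : ℕ} (x y : QDExpansion q d ℓ) : ℝ :=
  ∑ j ∈ Finset.range ℓ, G (carry q d (digitSum x y) (j + 1))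

/-- The mean of a function of a pair of expansions. -/
noncomputable def pairMean (q d : ℤ) {ℓ : ℕ} (F : QDExpansion q d ℓ → QDExpansion q d ℓ → E) : E :=
  ((q : ℝ) ^ (2 * ℓ))⁻¹ • ∑ x, ∑ y, F x y

/-- The mean of `f S c`, where `S` is the sum of `G` over all carries and `c` is the last carry. -/
noncomputable def carryMean (q d : ℤ) (G : ℤ → ℝ) (ℓ : ℕ) (f : ℝ → ℤ → E) : E :=
  pairMean q d fun x y : QDExpansion q d ℓ =>
    f (carrySum q d G x y) (carry q d (digitSum x y) ℓ)

lemma nextCarry_mem (q d s c : ℤ) : nextCarry q d s c ∈ ({1, -1, 0} : Finset ℤ) := by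
  unfold nextCarry
  split_ifs <;> simp

lemma nextCarry_eq_one_iff (q d s c : ℤ) : nextCarry q d s c = 1 ↔ q + d ≤ s + c := by
  unfold nextCarry
  split_ifs <;> simp <;> omega

lemma nextCarry_eq_neg_one_iff {q : ℤ} (hq : 0 ≤ q) (d s c : ℤ) :
    nextCarry q d s c = -1 ↔ s + c ≤ d - 1 := by
  unfold nextCarry
  split_ifs <;> simp <;> omega

lemma carry_succ (q d : ℤ) (s : ℕ → ℤ) (j : ℕ) :
    carry q d s (j + 1) = nextCarry q d (s j) (carry q d s j) := rfl

lemma carry_mem (q d : ℤ) (s : ℕ → ℤ) (j : ℕ) : carry q d s j ∈ ({1, -1, 0} : Finset ℤ) := by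
  cases j with
  | zero => simp [carry]
  | succ j => exact nextCarry_mem _ _ _ _

lemma carry_congr {q d : ℤ} {s t : ℕ → ℤ} {n : ℕ} (h : ∀ j < n, s j = t j) :
    ∀ j ≤ n, carry q d s j = carry q d t j := by
  intro j hj
  induction j with
  | zero => rfl
  | succ j ih => rw [carry_succ, carry_succ, ih (by omega), h j (by omega)]

/-- The antidiagonals `i + j = k` with `k < m` lie entirely inside the square because `m ≤ n`, so
the count is `1 + 2 + ⋯ + m`. -/
lemma card_filter_add_lt (n m : ℕ) (h : m ≤ n) :
    ((Finset.range n ×ˢ Finset.range n).filter fun p => p.1 + p.2 < m).card * 2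
      = m * (m + 1) := by
  have : ((Finset.range n ×ˢ Finset.range n).filter fun p => p.1 + p.2 < m)
      = (Finset.range m).biUnion fun k => Finset.HasAntidiagonal.antidiagonal k := by
    ext ⟨i, j⟩
    simp only [Finset.mem_filter, Finset.mem_product, Finset.mem_range, Finset.mem_biUnion,
      Finset.HasAntidiagonal.mem_antidiagonal]
    constructor
    · rintro ⟨-, h⟩
      exact ⟨_, h, rfl⟩
    · rintro ⟨k, hk, rfl⟩
      omega
  rw [this, Finset.card_biUnion]
  · simp only [Finset.Nat.card_antidiagonal]
    have := Finset.sum_range_id_mul_two (m + 1)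
    rw [Finset.sum_range_succ'] at this
    simpa [mul_comm] using this
  · intro k _ l _ hkl
    rw [Function.onFun, Finset.disjoint_left]
    rintro ⟨i, j⟩ h1 h2
    simp only [Finset.HasAntidiagonal.mem_antidiagonal] at h1 h2
    omega

/-- The value `m = -1` really occurs, for instance for the carry `-1` when `d = 0` and the incoming
carry is `1`; the formula correctly gives `0` there. -/
lemma card_filter_add_lt_int (q m : ℤ) (h0 : -1 ≤ m) (h : m ≤ q) :
    (((Finset.range q.toNat ×ˢ Finset.range q.toNat).filter
      fun p => ((p.1 : ℤ) + p.2 < m)).card : ℝ) = m * (m + 1) / 2 := by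
  obtain rfl | h0 : m = -1 ∨ 0 ≤ m := by omega
  · rw [Finset.filter_false_of_mem]
    · simp
    · intro p _
      omega
  · lift m to ℕ using h0
    have := card_filter_add_lt q.toNat m (by omega)
    rw [eq_div_iff (by norm_num)]
    push_cast
    norm_cast

/-- Measuring digits from the lowest digit `d` turns the condition into `i + j < -d - c`, a triangle
in the square of side `q`. -/
lemma card_nextCarry_neg {q d c : ℤ} (hqd : -q < d) (hd : d ≤ 0)
    (hc : c ∈ ({1, -1, 0} : Finset ℤ)) :
    ((Finset.univ.filter fun p : Set.Icc d (q + d - 1) × Set.Icc d (q + d - 1) =>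
      nextCarry q d (p.1 + p.2) c = -1).card : ℝ) = (d + c) * (d + c - 1) / 2 := by
  have hc' : c = 1 ∨ c = -1 ∨ c = 0 := by simpa using hc
  have := card_filter_add_lt_int q (-d - c) (by omega) (by omega)
  rw [show ((d : ℝ) + c) * (d + c - 1) / 2
    = ((-d - c : ℤ) : ℝ) * (((-d - c : ℤ) : ℝ) + 1) / 2 by push_cast; ring, ← this]
  congr 1
  refine Finset.card_bij' (fun p _ => ((p.1 - d : ℤ).toNat, (p.2 - d : ℤ).toNat))
    (fun p hp => (⟨d + p.1, ?_⟩, ⟨d + p.2, ?_⟩)) ?_ ?_ ?_ ?_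
  · simp only [Finset.mem_filter, Finset.mem_product, Finset.mem_range] at hp
    constructor <;> omega
  · simp only [Finset.mem_filter, Finset.mem_product, Finset.mem_range] at hp
    constructor <;> omega
  · rintro ⟨⟨a, ha1, ha2⟩, ⟨b, hb1, hb2⟩⟩ h
    simp only [Finset.mem_filter, Finset.mem_univ, true_and,
      nextCarry_eq_neg_one_iff (by omega : 0 ≤ q), Finset.mem_product, Finset.mem_range] at h ⊢
    omega
  · rintro ⟨i, j⟩ h
    simp only [Finset.mem_filter, Finset.mem_univ, true_and,
      nextCarry_eq_neg_one_iff (by omega : 0 ≤ q), Finset.mem_product, Finset.mem_range] at h ⊢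
    omega
  · rintro ⟨⟨a, ha1, ha2⟩, ⟨b, hb1, hb2⟩⟩ h
    ext <;> simp <;> omega
  · rintro ⟨i, j⟩ h
    simp

/-- Reflecting, i.e. measuring digits down from the highest digit `q + d - 1`, turns the condition
into `i + j < q - 1 + d + c`. -/
lemma card_nextCarry_pos {q d c : ℤ} (hqd : -q < d) (hd : d ≤ 0)
    (hc : c ∈ ({1, -1, 0} : Finset ℤ)) :
    ((Finset.univ.filter fun p : Set.Icc d (q + d - 1) × Set.Icc d (q + d - 1) =>
      nextCarry q d (p.1 + p.2) c = 1).card : ℝ) = (q + d + c) * (q + d + c - 1) / 2 := by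
  have hc' : c = 1 ∨ c = -1 ∨ c = 0 := by simpa using hc
  have := card_filter_add_lt_int q (q - 1 + d + c) (by omega) (by omega)
  rw [show ((q : ℝ) + d + c) * (q + d + c - 1) / 2
    = ((q - 1 + d + c : ℤ) : ℝ) * (((q - 1 + d + c : ℤ) : ℝ) + 1) / 2 by push_cast; ring, ← this]
  congr 1
  refine Finset.card_bij' (fun p _ => ((q + d - 1 - p.1 : ℤ).toNat, (q + d - 1 - p.2 : ℤ).toNat))
    (fun p hp => (⟨q + d - 1 - p.1, ?_⟩, ⟨q + d - 1 - p.2, ?_⟩)) ?_ ?_ ?_ ?_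
  · simp only [Finset.mem_filter, Finset.mem_product, Finset.mem_range] at hp
    constructor <;> omega
  · simp only [Finset.mem_filter, Finset.mem_product, Finset.mem_range] at hp
    constructor <;> omega
  · rintro ⟨⟨a, ha1, ha2⟩, ⟨b, hb1, hb2⟩⟩ h
    simp only [Finset.mem_filter, Finset.mem_univ, true_and, nextCarry_eq_one_iff,
      Finset.mem_product, Finset.mem_range] at h ⊢
    omega
  · rintro ⟨i, j⟩ h
    simp only [Finset.mem_filter, Finset.mem_univ, true_and, nextCarry_eq_one_iff,
      Finset.mem_product, Finset.mem_range] at h ⊢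
    omega
  · rintro ⟨⟨a, ha1, ha2⟩, ⟨b, hb1, hb2⟩⟩ h
    ext <;> simp <;> omega
  · rintro ⟨i, j⟩ h
    simp

lemma card_digits {q d : ℤ} (hq : 0 < q) :
    (Fintype.card (Set.Icc d (q + d - 1)) : ℝ) = q := by
  rw [Fintype.card_ofFinset, Int.card_Icc]
  have : ((q + d - 1 + 1 - d).toNat : ℤ) = q := by omega
  exact_mod_cast this

lemma sum_nextCarry {q d c : ℤ} (hqd : -q < d) (hd : d ≤ 0)
    (hc : c ∈ ({1, -1, 0} : Finset ℤ)) (f : ℤ → E) :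
    ∑ a : Set.Icc d (q + d - 1), ∑ b : Set.Icc d (q + d - 1), f (nextCarry q d (a + b) c)
      = ((q : ℝ) ^ 2) • transition q d f c := by
  have hq : (q : ℝ) ≠ 0 := by
    have : q ≠ 0 := by omega
    exact_mod_cast this
  rw [← Fintype.sum_prod_type'
    (f := fun a b : Set.Icc d (q + d - 1) => f (nextCarry q d (a + b) c))]
  have hcard := Finset.card_eq_sum_card_fiberwise (s := Finset.univ)
    (f := fun p : Set.Icc d (q + d - 1) × Set.Icc d (q + d - 1) =>
      nextCarry q d (p.1 + p.2) c) (t := {1, -1, 0}) fun p _ => nextCarry_mem _ _ _ _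
  rw [← Finset.sum_fiberwise_of_maps_to (s := Finset.univ) (t := {1, -1, 0})
    (g := fun p : Set.Icc d (q + d - 1) × Set.Icc d (q + d - 1) => nextCarry q d (p.1 + p.2) c)
    fun p _ => nextCarry_mem _ _ _ _]
  have key : ∀ k : ℤ, ∑ p : Set.Icc d (q + d - 1) × Set.Icc d (q + d - 1) with
      nextCarry q d (p.1 + p.2) c = k, f (nextCarry q d (p.1 + p.2) c)
      = ((Finset.univ.filter fun p : Set.Icc d (q + d - 1) × Set.Icc d (q + d - 1) =>
      nextCarry q d (p.1 + p.2) c = k).card : ℝ) • f k := by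
    intro k
    rw [Finset.sum_congr rfl (g := fun _ => f k), Finset.sum_const, Nat.cast_smul_eq_nsmul]
    intro p hp
    rw [(Finset.mem_filter.1 hp).2]
  have hpos := card_nextCarry_pos hqd hd hc
  have hneg := card_nextCarry_neg hqd hd hc
  -- The pairs producing carry `0` are not counted directly: they are what remains of all `q²`
  -- pairs.
  have hcard' := congrArg (Nat.cast : ℕ → ℝ) hcard
  rw [Finset.card_univ, Fintype.card_prod, Nat.cast_mul, card_digits (by omega)] at hcard'
  simp only [key]
  rw [Finset.sum_insert (by simp), Finset.sum_insert (by simp), Finset.sum_singleton] at hcard' ⊢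
  push_cast at hcard'
  rw [hpos, hneg] at hcard' ⊢
  rw [transition, smul_add, smul_add, smul_smul, smul_smul, smul_smul, ← add_assoc]
  congr 2
  · rw [posProb]; field_simp
  · congr 2
    rw [negProb]; field_simp
  · rw [posProb, negProb]
    have : ∀ z : ℝ, (q : ℝ) * q = (q + d + c) * (q + d + c - 1) / 2 +
      ((d + c) * (d + c - 1) / 2 + z) → z = q ^ 2 * (1 - (q + d + c) * (q + d + c - 1) / (2 * q ^ 2)
        - (d + c) * (d + c - 1) / (2 * q ^ 2)) := by
      intro z hz
      field_simp
      linarith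
    exact this _ hcard'

lemma digitSum_snoc_of_lt {q d : ℤ} {ℓ : ℕ} (x y : QDExpansion q d ℓ)
    (a b : Set.Icc d (q + d - 1)) {j : ℕ} (hj : j < ℓ) :
    digitSum (Fin.snoc x a : QDExpansion q d (ℓ + 1)) (Fin.snoc y b : QDExpansion q d (ℓ + 1)) j
      = digitSum x y j := by
  rw [digitSum, digitSum, dif_pos hj, dif_pos (by omega)]
  simp [Fin.snoc, hj]

lemma digitSum_snoc_last {q d : ℤ} {ℓ : ℕ} (x y : QDExpansion q d ℓ)
    (a b : Set.Icc d (q + d - 1)) :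
    digitSum (Fin.snoc x a : QDExpansion q d (ℓ + 1)) (Fin.snoc y b : QDExpansion q d (ℓ + 1)) ℓ
      = a + b := by
  rw [digitSum, dif_pos (by omega)]
  simp [Fin.snoc]

lemma carry_snoc_of_le {q d : ℤ} {ℓ : ℕ} (x y : QDExpansion q d ℓ)
    (a b : Set.Icc d (q + d - 1)) {j : ℕ} (hj : j ≤ ℓ) :
    carry q d (digitSum (Fin.snoc x a : QDExpansion q d (ℓ + 1))
      (Fin.snoc y b : QDExpansion q d (ℓ + 1))) j = carry q d (digitSum x y) j :=
  carry_congr (fun _ hj => digitSum_snoc_of_lt x y a b hj) j hj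

lemma carry_snoc_last {q d : ℤ} {ℓ : ℕ} (x y : QDExpansion q d ℓ)
    (a b : Set.Icc d (q + d - 1)) :
    carry q d (digitSum (Fin.snoc x a : QDExpansion q d (ℓ + 1))
      (Fin.snoc y b : QDExpansion q d (ℓ + 1))) (ℓ + 1)
      = nextCarry q d (a + b) (carry q d (digitSum x y) ℓ) := by
  rw [carry_succ, digitSum_snoc_last, carry_snoc_of_le _ _ _ _ le_rfl]

lemma carrySum_snoc {q d : ℤ} (G : ℤ → ℝ) {ℓ : ℕ} (x y : QDExpansion q d ℓ)
    (a b : Set.Icc d (q + d - 1)) :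
    carrySum q d G (Fin.snoc x a : QDExpansion q d (ℓ + 1))
      (Fin.snoc y b : QDExpansion q d (ℓ + 1))
      = carrySum q d G x y + G (nextCarry q d (a + b) (carry q d (digitSum x y) ℓ)) := by
  rw [carrySum, Finset.sum_range_succ, carry_snoc_last, carrySum]
  congr 1
  refine Finset.sum_congr rfl fun j hj => ?_
  rw [carry_snoc_of_le _ _ _ _ (Finset.mem_range.1 hj)]

/-- The digit split off is the most significant one. Carries propagate upwards, so those up to `c_ℓ`
do not see it. -/
lemma sum_expansion_succ {E : Type*} [AddCommMonoid E] {q d : ℤ} {ℓ : ℕ}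
    (F : QDExpansion q d (ℓ + 1) → E) :
    ∑ x, F x = ∑ x : QDExpansion q d ℓ, ∑ a : Set.Icc d (q + d - 1),
      F (Fin.snoc x a : QDExpansion q d (ℓ + 1)) := by
  rw [← (Fin.snocEquiv fun _ : Fin (ℓ + 1) => Set.Icc d (q + d - 1)).sum_comp,
    Fintype.sum_prod_type_right]
  rfl

lemma carryMean_zero (q d : ℤ) (G : ℤ → ℝ) (f : ℝ → ℤ → E) : carryMean q d G 0 f = f 0 0 := by
  simp [carryMean, pairMean, carrySum, carry]

/-- The one-step recursion for means over the chain of carries. -/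
lemma carryMean_succ {q d : ℤ} (hqd : -q < d) (hd : d ≤ 0) (G : ℤ → ℝ) (ℓ : ℕ)
    (f : ℝ → ℤ → E) :
    carryMean q d G (ℓ + 1) f
      = carryMean q d G ℓ fun s c => transition q d (fun k => f (s + G k) k) c := by
  have hq : (q : ℝ) ≠ 0 := by
    have : q ≠ 0 := by omega
    exact_mod_cast this
  have : ∀ x y : QDExpansion q d ℓ,
      ∑ a : Set.Icc d (q + d - 1), ∑ b : Set.Icc d (q + d - 1),
        f (carrySum q d G (Fin.snoc x a : QDExpansion q d (ℓ + 1))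
            (Fin.snoc y b : QDExpansion q d (ℓ + 1)))
          (carry q d (digitSum (Fin.snoc x a : QDExpansion q d (ℓ + 1))
            (Fin.snoc y b : QDExpansion q d (ℓ + 1))) (ℓ + 1))
      = ((q : ℝ) ^ 2) • transition q d (fun k => f (carrySum q d G x y + G k) k)
          (carry q d (digitSum x y) ℓ) := by
    intro x y
    rw [← sum_nextCarry hqd hd (carry_mem _ _ _ _)]
    simp only [carrySum_snoc, carry_snoc_last]
  rw [carryMean, carryMean, pairMean, pairMean, sum_expansion_succ]
  simp only [sum_expansion_succ]
  simp only [Finset.sum_comm (s := (Finset.univ : Finset (Set.Icc d (q + d - 1))))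
    (t := (Finset.univ : Finset (QDExpansion q d ℓ))), this, ← Finset.smul_sum, smul_smul]
  congr 1
  field_simp
  ring

end Combinatorics

/-! ### Linearity and boundedness of means over the chain. -/

section Means

variable {E : Type*} [NormedAddCommGroup E] [NormedSpace ℝ E]

lemma card_expansion {q d : ℤ} (hq : 0 < q) (ℓ : ℕ) :
    (Fintype.card (QDExpansion q d ℓ) : ℝ) = q ^ ℓ := by
  rw [Fintype.card_fun, Nat.cast_pow, card_digits hq, Fintype.card_fin]

lemma norm_pairMean_le {q d : ℤ} (hq : 0 < q) {ℓ : ℕ}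
    {F : QDExpansion q d ℓ → QDExpansion q d ℓ → E} {C : ℝ} (h : ∀ x y, ‖F x y‖ ≤ C) :
    ‖pairMean q d F‖ ≤ C := by
  have hq' : (0 : ℝ) < q := by exact_mod_cast hq
  rw [pairMean, norm_smul, norm_inv, norm_pow, Real.norm_of_nonneg hq'.le,
    inv_mul_le_iff₀ (by positivity)]
  calc ‖∑ x, ∑ y, F x y‖ ≤ ∑ _x : QDExpansion q d ℓ, ∑ _y : QDExpansion q d ℓ, C :=
        norm_sum_le_of_le _ fun x _ => norm_sum_le_of_le _ fun y _ => h x y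
    _ = (q : ℝ) ^ (2 * ℓ) * C := by
        simp only [Finset.sum_const, Finset.card_univ, nsmul_eq_mul, card_expansion hq]
        ring

lemma norm_carryMean_le {q d : ℤ} (hq : 0 < q) {G : ℤ → ℝ} {ℓ : ℕ} {f : ℝ → ℤ → E} {C : ℝ}
    (h : ∀ s, ∀ c ∈ ({1, -1, 0} : Finset ℤ), ‖f s c‖ ≤ C) :
    ‖carryMean q d G ℓ f‖ ≤ C :=
  norm_pairMean_le hq fun _ _ => h _ _ (carry_mem _ _ _ _)

lemma carryMean_congr {q d : ℤ} {G : ℤ → ℝ} {ℓ : ℕ} {f g : ℝ → ℤ → E}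
    (h : ∀ s, ∀ c ∈ ({1, -1, 0} : Finset ℤ), f s c = g s c) :
    carryMean q d G ℓ f = carryMean q d G ℓ g := by
  simp only [carryMean, pairMean, h _ _ (carry_mem _ _ _ _)]

lemma carryMean_add (q d : ℤ) (G : ℤ → ℝ) (ℓ : ℕ) (f g : ℝ → ℤ → E) :
    carryMean q d G ℓ (fun s c => f s c + g s c)
      = carryMean q d G ℓ f + carryMean q d G ℓ g := by
  simp only [carryMean, pairMean, Finset.sum_add_distrib, smul_add]

lemma carryMean_sub (q d : ℤ) (G : ℤ → ℝ) (ℓ : ℕ) (f g : ℝ → ℤ → E) :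
    carryMean q d G ℓ (fun s c => f s c - g s c)
      = carryMean q d G ℓ f - carryMean q d G ℓ g := by
  simp only [carryMean, pairMean, Finset.sum_sub_distrib, smul_sub]

lemma carryMean_const_mul {𝕜 : Type*} [RCLike 𝕜] (q d : ℤ) (G : ℤ → ℝ) (ℓ : ℕ) (a : 𝕜)
    (f : ℝ → ℤ → 𝕜) :
    carryMean q d G ℓ (fun s c => a * f s c) = a * carryMean q d G ℓ f := by
  simp only [carryMean, pairMean, ← Finset.mul_sum, mul_smul_comm]

lemma carryMean_const {q d : ℤ} (hq : 0 < q) (G : ℤ → ℝ) (ℓ : ℕ) (a : ℝ) :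
    carryMean q d G ℓ (fun _ _ => a) = a := by
  have hq' : (0 : ℝ) < q := by exact_mod_cast hq
  simp only [carryMean, pairMean, Finset.sum_const, Finset.card_univ, nsmul_eq_mul,
    card_expansion hq, smul_eq_mul]
  field_simp
  ring

lemma exists_bound_carryMean {q d : ℤ} (hq : 0 < q) (G : ℤ → ℝ) (f : ℤ → ℝ) :
    ∃ C, 0 ≤ C ∧ ∀ ℓ, |carryMean q d G ℓ fun _ c => f c| ≤ C := by
  refine ⟨|f 1| + |f (-1)| + |f 0|, by positivity, fun ℓ => ?_⟩
  rw [← Real.norm_eq_abs]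
  refine norm_carryMean_le hq fun s c hc => ?_
  have hc' : c = 1 ∨ c = -1 ∨ c = 0 := by simpa using hc
  have h1 := abs_nonneg (f 1)
  have h2 := abs_nonneg (f (-1))
  have h3 := abs_nonneg (f 0)
  rw [Real.norm_eq_abs]
  obtain rfl | rfl | rfl := hc' <;> linarith

end Means

/-! ### Explicit solutions of the Poisson equations. -/

section Poisson

/-- The coefficient of `c` in the solution of the Poisson equation for `f₁ c + f₂ c²`. -/
noncomputable def corrLin (q d f₁ f₂ : ℝ) : ℝ :=
  f₁ / (q - 1) + f₂ * q * (2 * d + q - 1) / ((q - 1) * (q ^ 2 - 1))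

/-- The coefficient of `c²` in the solution of the Poisson equation for `f₁ c + f₂ c²`. -/
noncomputable def corrSq (q f₂ : ℝ) : ℝ := f₂ / (q ^ 2 - 1)

/-- The stationary mean of the function `f₀ + f₁ c + f₂ c²` of the carry. -/
noncomputable def statMean (q d f₀ f₁ f₂ : ℝ) : ℝ :=
  f₀ + f₁ * (meanPos q d - meanNeg q d) + f₂ * (meanPos q d + meanNeg q d)

/-- The quadratic polynomial with the coefficients `f₀, f₁, f₂`. -/
def quad (f₀ f₁ f₂ : ℝ) (c : ℤ) : ℝ := f₀ + f₁ * c + f₂ * c ^ 2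

/-- The solution of the Poisson equation for `f₁ c + f₂ c²`. -/
noncomputable def corr (q d f₁ f₂ : ℝ) (c : ℤ) : ℝ := quad 0 (corrLin q d f₁ f₂) (corrSq q f₂) c

/-- Triangularity of the operator on `1, c, c²`. The factors `1/q` and `1/q²` on the diagonal make
the Poisson equation solvable and make correlations contract. -/
lemma transition_quad {q : ℝ} (hq : q ≠ 0) (d f₀ f₁ f₂ : ℝ) (c : ℤ) :
    transition q d (quad f₀ f₁ f₂) c = f₀ + f₁ * (c / q + (q - 1 + 2 * d) / (2 * q))
      + f₂ * (c ^ 2 / q ^ 2 + (2 * d + q - 1) / q ^ 2 * c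
        + (2 * d ^ 2 + 2 * (q - 1) * d + q ^ 2 - q) / (2 * q ^ 2)) := by
  simp only [transition, quad, posProb, negProb, smul_eq_mul]
  push_cast
  field_simp
  ring

lemma transition_congr {E : Type*} [AddCommGroup E] [Module ℝ E] {q d : ℝ} {f g : ℤ → E}
    (h : ∀ c ∈ ({1, -1, 0} : Finset ℤ), f c = g c) (c : ℤ) :
    transition q d f c = transition q d g c := by
  simp only [transition, h 1 (by simp), h (-1) (by simp), h 0 (by simp)]

/-- The Poisson equation. -/
lemma transition_add_corr {q : ℝ} (hq : 1 < q) (d f₀ f₁ f₂ : ℝ) (c : ℤ) :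
    transition q d (fun k => quad f₀ f₁ f₂ k + corr q d f₁ f₂ k) c
      = corr q d f₁ f₂ c + statMean q d f₀ f₁ f₂ := by
  have h1 : q - 1 ≠ 0 := by linarith
  have h2 : q + 1 ≠ 0 := by linarith
  have h0 : q ≠ 0 := by linarith
  have : (fun k => quad f₀ f₁ f₂ k + corr q d f₁ f₂ k)
      = quad f₀ (f₁ + corrLin q d f₁ f₂) (f₂ + corrSq q f₂) := by
    ext k
    simp only [corr, quad]
    ring
  rw [this, transition_quad h0, corr, quad, statMean, corrLin, corrSq, meanPos, meanNeg,
    show q ^ 2 - 1 = (q - 1) * (q + 1) by ring]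
  field_simp
  ring

/-- The coefficient of `c` in `α [c = 1] + β [c = -1]` is `(α - β) / 2`, that of `c²` is
`(α + β) / 2`. This is the function `α [c = 1] + β [c = -1]` minus its stationary mean. -/
noncomputable def weight (q d α β : ℝ) : ℤ → ℝ :=
  quad (-(α * meanPos q d + β * meanNeg q d)) ((α - β) / 2) ((α + β) / 2)

/-- The solution of the Poisson equation for `weight`. -/
noncomputable def weightCorr (q d α β : ℝ) : ℤ → ℝ := corr q d ((α - β) / 2) ((α + β) / 2)

/-- Half of the asymptotic variance. -/
noncomputable def halfVar (q d α β : ℝ) : ℝ :=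
  (α ^ 2 * varPos q d + 2 * α * β * covConst q d + β ^ 2 * varNeg q d) / 2

lemma transition_weight {q : ℝ} (hq : 1 < q) (d α β : ℝ) (c : ℤ) :
    transition q d (fun k => weight q d α β k + weightCorr q d α β k) c
      = weightCorr q d α β c := by
  rw [weight, weightCorr, transition_add_corr hq, statMean]
  ring

/-- On the three states `G²/2 + Gh` agrees with a quadratic polynomial, so the first-order Poisson
solution applies again. Its stationary mean is half the asymptotic variance; this is where the
stated constants `v_1`, `v_{-1}`, `c` are verified. -/
lemma exists_second_corr {q : ℝ} (hq : 1 < q) (d α β : ℝ) :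
    ∃ κ : ℤ → ℝ, ∀ c, transition q d (fun k => weight q d α β k ^ 2 / 2
      + weight q d α β k * weightCorr q d α β k + κ k) c = κ c + halfVar q d α β := by
  have h1 : q - 1 ≠ 0 := by linarith
  have h2 : q + 1 ≠ 0 := by linarith
  have h0 : q ≠ 0 := by linarith
  set m := α * meanPos q d + β * meanNeg q d with hm
  set A := (α - β) / 2 with hA
  set B := (α + β) / 2 with hB
  set a := A / 2 + corrLin q d A B with ha
  set b := B / 2 + corrSq q B with hb
  -- Coefficients of `G (G/2 + h) = (-m + A k + B k²)(-m/2 + a k + b k²)` after reducing with `k³ =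
  -- k` and `k⁴ = k²`, valid for `k ∈ {1, -1, 0}`.
  set w₁ := A * b + B * a - m * a - m * A / 2 with hw₁
  set w₂ := A * a + B * b - m * b - m * B / 2 with hw₂
  refine ⟨corr q d w₁ w₂, fun c => ?_⟩
  rw [transition_congr (g := fun k => quad (m ^ 2 / 2) w₁ w₂ k + corr q d w₁ w₂ k),
    transition_add_corr hq]
  · congr 1
    rw [statMean, halfVar, hw₁, hw₂, ha, hb, hm, hA, hB, corrLin, corrSq, meanPos, meanNeg,
      varPos, varNeg, covConst, show q ^ 2 - 1 = (q - 1) * (q + 1) by ring]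
    field_simp
    ring
  · intro k hk
    congr 1
    have hk' : k = 1 ∨ k = -1 ∨ k = 0 := by simpa using hk
    have hwt : weight q d α β = quad (-m) A B := rfl
    have hcr : weightCorr q d α β = quad 0 (corrLin q d A B) (corrSq q B) := rfl
    rw [hwt, hcr]
    simp only [quad]
    obtain rfl | rfl | rfl := hk' <;> simp only [hw₁, hw₂, ha, hb] <;> push_cast <;> ring

end Poisson

/-! ### First and second moments of the weighted sum. -/

section Moments

lemma abs_le_of_contraction {x : ℕ → ℝ} {r C : ℝ} (hr0 : 0 ≤ r) (hr : r ≤ 1 / 2)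
    (h : ∀ n, |x (n + 1) - r * x n| ≤ C) (n : ℕ) : |x n| ≤ |x 0| + 2 * C := by
  have hC : 0 ≤ C := (abs_nonneg _).trans (h 0)
  induction n with
  | zero => linarith
  | succ n ih =>
    have h1 : |x (n + 1)| ≤ |x (n + 1) - r * x n| + |r * x n| := by
      simpa using abs_add_le (x (n + 1) - r * x n) (r * x n)
    rw [abs_mul, abs_of_nonneg hr0] at h1
    have h2 : r * |x n| ≤ 1 / 2 * |x n| := mul_le_mul_of_nonneg_right hr (abs_nonneg _)
    have := h n
    have := abs_nonneg (x 0)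
    linarith

/-- By the Poisson equation `S + h(c_ℓ)` has constant mean, and `h` is bounded on the states. -/
lemma exists_bound_mean {q d : ℤ} (hq : 2 ≤ q) (hqd : -q < d) (hd : d ≤ 0)
    (α β : ℝ) : ∃ C, 0 ≤ C ∧ ∀ ℓ,
    |carryMean q d (weight q d α β) ℓ fun s _ => s| ≤ C := by
  have hq1 : (1 : ℝ) < q := by exact_mod_cast hq
  obtain ⟨C, hC, h⟩ := exists_bound_carryMean (q := q) (d := d) (by omega) (weight q d α β)
    (weightCorr q d α β)
  have key : ∀ ℓ, carryMean q d (weight q d α β) ℓ (fun s c => s + weightCorr q d α β c)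
      = weightCorr q d α β 0 := by
    intro ℓ
    induction ℓ with
    | zero => rw [carryMean_zero, zero_add]
    | succ ℓ ih =>
      rw [carryMean_succ hqd hd, ← ih]
      refine carryMean_congr fun s c _ => ?_
      have := transition_weight hq1 d α β c
      simp only [transition, smul_eq_mul] at this ⊢
      linear_combination this
  refine ⟨|weightCorr q d α β 0| + C, by positivity, fun ℓ => ?_⟩
  have := key ℓ
  rw [carryMean_add] at this
  rw [eq_sub_of_add_eq this]
  exact (abs_sub _ _).trans (add_le_add le_rfl (h ℓ))

/-- Correlations of the sum of the weights with functions of the last carry are bounded. -/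
lemma exists_bound_mean_mul {q d : ℤ} (hq : 2 ≤ q) (hqd : -q < d) (hd : d ≤ 0)
    (α β : ℝ) (f₁ f₂ : ℝ) : ∃ C, 0 ≤ C ∧ ∀ ℓ,
    |carryMean q d (weight q d α β) ℓ fun s c => s * (f₁ * c + f₂ * c ^ 2)| ≤ C := by
  have hq2 : (2 : ℝ) ≤ q := by exact_mod_cast hq
  have hq0 : (q : ℝ) ≠ 0 := by linarith
  set G := weight q d α β with hG
  obtain ⟨M, hM, hm⟩ := exists_bound_mean hq hqd hd α β
  -- One step replaces `g₁ c + g₂ c²` by its image under the transition operator. The error consists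
  -- of the constant term of that image times the mean of `S`, already bounded, and the contribution
  -- of the newly added weight, a bounded function of the carry.
  have step : ∀ (g₁ g₂ : ℝ), ∃ C, 0 ≤ C ∧ ∀ ℓ,
      |carryMean q d G (ℓ + 1) (fun s c => s * (g₁ * c + g₂ * c ^ 2))
        - carryMean q d G ℓ (fun s c => s * ((g₁ / q + g₂ * ((2 * d + q - 1) / q ^ 2)) * c
          + g₂ / q ^ 2 * c ^ 2))| ≤ C := by
    intro g₁ g₂
    obtain ⟨C, hC, h⟩ := exists_bound_carryMean (q := q) (d := d) (by omega) G
      (transition q d fun k => G k * (g₁ * k + g₂ * k ^ 2))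
    set κ : ℝ := transition q d (quad 0 g₁ g₂) 0
    refine ⟨|κ| * M + C, by positivity, fun ℓ => ?_⟩
    have : carryMean q d G (ℓ + 1) (fun s c => s * (g₁ * c + g₂ * c ^ 2))
        - carryMean q d G ℓ (fun s c => s * ((g₁ / q + g₂ * ((2 * d + q - 1) / q ^ 2)) * c
          + g₂ / q ^ 2 * c ^ 2)) = κ * carryMean q d G ℓ (fun s _ => s)
        + carryMean q d G ℓ fun _ c => transition q d (fun k => G k * (g₁ * k + g₂ * k ^ 2)) c := by
      rw [carryMean_succ hqd hd, ← carryMean_sub, ← carryMean_const_mul (𝕜 := ℝ), ← carryMean_add]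
      refine carryMean_congr fun s c _ => ?_
      have h1 := transition_quad hq0 d 0 g₁ g₂ c
      have h0 := transition_quad hq0 d 0 g₁ g₂ 0
      change κ = _ at h0
      simp only [transition, smul_eq_mul, quad] at h1 ⊢
      rw [h0]
      push_cast
      linear_combination s * h1
    rw [this]
    refine (abs_add_le _ _).trans (add_le_add ?_ (h ℓ))
    rw [abs_mul]
    exact mul_le_mul_of_nonneg_left (hm ℓ) (abs_nonneg _)
  -- The recursion is triangular: first the correlation with `c` contracts by `1/q`, then the one
  -- with `c²` contracts by `1/q²` up to a multiple of the first.
  have hr1 : (1 : ℝ) / q ≤ 1 / 2 := one_div_le_one_div_of_le (by norm_num) hq2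
  have hr2 : (1 : ℝ) / q ^ 2 ≤ 1 / 2 := one_div_le_one_div_of_le (by norm_num) (by nlinarith)
  obtain ⟨C₁, hC₁, h₁⟩ := step 1 0
  have b₁ : ∀ ℓ, |carryMean q d G ℓ fun s c => s * c| ≤ 2 * C₁ := by
    intro ℓ
    have := abs_le_of_contraction (x := fun ℓ => carryMean q d G ℓ fun s c => s * c)
      (by positivity) hr1 (C := C₁) (fun n => ?_) ℓ
    · simpa [carryMean_zero] using this
    · rw [← carryMean_const_mul (𝕜 := ℝ)]
      convert h₁ n using 5 <;> first | rfl | (ext; ring)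
  obtain ⟨C₂, hC₂, h₂⟩ := step 0 1
  set κ₂ : ℝ := (2 * d + q - 1) / q ^ 2 with hκ₂
  have b₂ : ∀ ℓ, |carryMean q d G ℓ fun s c => s * c ^ 2| ≤ 2 * (C₂ + |κ₂| * (2 * C₁)) := by
    intro ℓ
    have := abs_le_of_contraction (x := fun ℓ => carryMean q d G ℓ fun s c => s * c ^ 2)
      (by positivity) hr2 (C := C₂ + |κ₂| * (2 * C₁)) (fun n => ?_) ℓ
    · simpa [carryMean_zero] using this
    · have e : carryMean q d G (n + 1) (fun s c => s * c ^ 2)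
          - 1 / q ^ 2 * carryMean q d G n (fun s c => s * c ^ 2)
          = (carryMean q d G (n + 1) (fun s c => s * ((0 : ℝ) * c + 1 * c ^ 2))
          - carryMean q d G n (fun s c => s * (((0 : ℝ) / q + 1 * κ₂) * c
          + 1 / q ^ 2 * c ^ 2))) + κ₂ * carryMean q d G n fun s c => s * c := by
        rw [← carryMean_const_mul (𝕜 := ℝ), ← carryMean_const_mul (𝕜 := ℝ), sub_add,
          ← carryMean_sub]
        congr 2 <;> ext s c <;> ring
      rw [e]
      refine (abs_add_le _ _).trans (add_le_add (h₂ n) ?_)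
      rw [abs_mul]
      exact mul_le_mul_of_nonneg_left (b₁ n) (abs_nonneg _)
  refine ⟨|f₁| * (2 * C₁) + |f₂| * (2 * (C₂ + |κ₂| * (2 * C₁))), by positivity, fun ℓ => ?_⟩
  have e : carryMean q d G ℓ (fun s c => s * (f₁ * c + f₂ * c ^ 2))
      = f₁ * carryMean q d G ℓ (fun s c => s * c)
        + f₂ * carryMean q d G ℓ (fun s c => s * c ^ 2) := by
    rw [← carryMean_const_mul (𝕜 := ℝ), ← carryMean_const_mul (𝕜 := ℝ), ← carryMean_add]
    congr 1
    ext s c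
    ring
  rw [e]
  refine (abs_add_le _ _).trans ?_
  rw [abs_mul, abs_mul]
  exact add_le_add (mul_le_mul_of_nonneg_left (b₁ ℓ) (abs_nonneg _))
    (mul_le_mul_of_nonneg_left (b₂ ℓ) (abs_nonneg _))

/-- The mean of `S² + 2 S h(c_ℓ) + 2 κ(c_ℓ)` increases by exactly `2 * halfVar q d α β` per step,
and both correction terms have bounded mean. -/
lemma exists_bound_second_moment {q d : ℤ} (hq : 2 ≤ q) (hqd : -q < d) (hd : d ≤ 0)
    (α β : ℝ) : ∃ C, 0 ≤ C ∧ ∀ ℓ : ℕ,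
    |carryMean q d (weight q d α β) ℓ (fun s _ => s ^ 2) - 2 * halfVar q d α β * ℓ| ≤ C := by
  have hq1 : (1 : ℝ) < q := by exact_mod_cast hq
  obtain ⟨κ, hκ⟩ := exists_second_corr hq1 d α β
  obtain ⟨C₁, hC₁, h₁⟩ := exists_bound_carryMean (q := q) (d := d) (by omega) (weight q d α β) κ
  obtain ⟨C₂, hC₂, h₂⟩ := exists_bound_mean_mul hq hqd hd α β
    (corrLin q d ((α - β) / 2) ((α + β) / 2)) (corrSq q ((α + β) / 2))
  have hcorr : ∀ c, corrLin q d ((α - β) / 2) ((α + β) / 2) * c + corrSq q ((α + β) / 2) * c ^ 2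
      = weightCorr q d α β c := by
    intro c
    rw [weightCorr, corr, quad, zero_add]
  simp only [hcorr] at h₂
  have key : ∀ ℓ : ℕ, carryMean q d (weight q d α β) ℓ
      (fun s c => s ^ 2 + (2 * (s * weightCorr q d α β c) + 2 * κ c))
      = 2 * κ 0 + 2 * halfVar q d α β * ℓ := by
    intro ℓ
    induction ℓ with
    | zero => rw [carryMean_zero]; simp
    | succ ℓ ih =>
      rw [carryMean_succ hqd hd, Nat.cast_succ, mul_add, ← add_assoc, ← ih, mul_one,
        ← carryMean_const (q := q) (d := d) (by omega) (weight q d α β) ℓ (2 * halfVar q d α β),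
        ← carryMean_add]
      refine carryMean_congr fun s c _ => ?_
      have e1 := transition_weight hq1 d α β c
      have e2 := hκ c
      simp only [transition, smul_eq_mul] at e1 e2 ⊢
      linear_combination 2 * s * e1 + 2 * e2
  refine ⟨2 * |κ 0| + 2 * C₂ + 2 * C₁, by positivity, fun ℓ => ?_⟩
  have := key ℓ
  rw [carryMean_add, carryMean_add, carryMean_const_mul (𝕜 := ℝ),
    carryMean_const_mul (𝕜 := ℝ)] at this
  have a1 := abs_le.1 (h₁ ℓ)
  have a2 := abs_le.1 (h₂ ℓ)
  have a3 := neg_abs_le (κ 0)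
  have a4 := le_abs_self (κ 0)
  rw [abs_le]
  constructor <;> linarith [a1.1, a1.2, a2.1, a2.2]

end Moments

/-! ### Gaussian limit of the characteristic function via an approximate eigenvector. -/

section CharacteristicFunction

open Topology

/-- The second-order approximation `1 + z h + z² κ` of the eigenvector of the transition operator
twisted by `exp (z G)`. -/
noncomputable def approxEigen (h κ : ℤ → ℝ) (z : ℂ) (k : ℤ) : ℂ := 1 + z * h k + z ^ 2 * κ k

lemma continuous_approxEigen (h κ : ℤ → ℝ) (k : ℤ) :
    Continuous fun z => approxEigen h κ z k := by
  unfold approxEigen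
  fun_prop

lemma isBigO_exp_mul_sub (a : ℝ) :
    (fun z : ℂ => Complex.exp (z * a) - (1 + z * a + (z * a) ^ 2 / 2)) =O[𝓝 0]
      fun z => z ^ 3 := by
  have h1 := Complex.exp_sub_sum_range_isBigO_pow 3
  have h2 : Tendsto (fun z : ℂ => z * a) (𝓝 0) (𝓝 0) := by
    have : Continuous fun z : ℂ => z * a := by fun_prop
    simpa using this.tendsto 0
  have h3 := h1.comp_tendsto h2
  refine IsBigO.trans (f := fun z : ℂ => Complex.exp (z * a) - (1 + z * a + (z * a) ^ 2 / 2))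
    (g := fun z : ℂ => (z * a) ^ 3) ?_ ?_
  · refine h3.congr_left fun z => ?_
    simp [Finset.sum_range_succ]
  · simp only [mul_pow, mul_comm _ ((a : ℂ) ^ 3)]
    exact isBigO_const_mul_self _ _ _

/-- The approximate eigenvector equation, with an error of third order. -/
lemma isBigO_approxEigen {q d v : ℝ} {G h κ : ℤ → ℝ} {c : ℤ}
    (h₁ : transition q d (fun k => G k + h k) c = h c)
    (h₂ : transition q d (fun k => G k ^ 2 / 2 + G k * h k + κ k) c = κ c + v) :
    (fun z : ℂ => transition q d (fun k => Complex.exp (z * G k) * approxEigen h κ z k) c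
      - (1 + z ^ 2 * v) * approxEigen h κ z c) =O[𝓝 0] fun z => z ^ 3 := by
  have hF : ∀ k, (fun z => (Complex.exp (z * G k) - (1 + z * G k + (z * G k) ^ 2 / 2))
      * approxEigen h κ z k) =O[𝓝 0] fun z => z ^ 3 := by
    intro k
    have h1 := (isBigO_exp_mul_sub (G k)).mul
      ((continuous_approxEigen h κ k).tendsto 0 |>.isBigO_one ℂ)
    simpa using h1
  -- After replacing the exponential by its quadratic Taylor polynomial, the terms of order at least
  -- three are `z³` times this function, which is bounded near `0`.
  have hQ : Continuous fun z : ℂ => transition q d (fun k => (G k : ℂ) * κ k + G k ^ 2 / 2 * h k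
      + z * (G k ^ 2 / 2 * κ k)) c - v * h c - z * (v * κ c) := by
    unfold transition
    fun_prop
  have hQ' := (isBigO_refl (fun z : ℂ => z ^ 3) (𝓝 0)).mul (hQ.tendsto 0 |>.isBigO_one ℂ)
  simp only [mul_one] at hQ'
  have hT := ((((hF 1).const_mul_left (posProb q d c : ℂ)).add
    ((hF (-1)).const_mul_left (negProb q d c : ℂ))).add
    ((hF 0).const_mul_left ((1 - posProb q d c - negProb q d c : ℝ) : ℂ))).add hQ'
  refine hT.congr_left fun z => ?_
  have e₁ := congrArg (Complex.ofReal) h₁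
  have e₂ := congrArg (Complex.ofReal) h₂
  simp only [transition, smul_eq_mul, Complex.real_smul, approxEigen] at e₁ e₂ ⊢
  push_cast at e₁ e₂ ⊢
  -- The coefficients of `z` and `z²` cancel by the first and second Poisson equations respectively.
  linear_combination -z * e₁ - z ^ 2 * e₂

/-- As `‖r‖ ≤ 1`, earlier errors are not amplified, so the one-step errors merely add up. -/
lemma norm_sub_pow_mul_le {a : ℕ → ℂ} {r : ℂ} {ε : ℝ} (hr : ‖r‖ ≤ 1)
    (h : ∀ j, ‖a (j + 1) - r * a j‖ ≤ ε) (n : ℕ) : ‖a n - r ^ n * a 0‖ ≤ n * ε := by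
  induction n with
  | zero => simp
  | succ n ih =>
    have : a (n + 1) - r ^ (n + 1) * a 0 = (a (n + 1) - r * a n) + r * (a n - r ^ n * a 0) := by
      ring
    rw [this]
    refine (norm_add_le _ _).trans ?_
    rw [norm_mul]
    have h1 : ‖r‖ * ‖a n - r ^ n * a 0‖ ≤ 1 * ‖a n - r ^ n * a 0‖ :=
      mul_le_mul_of_nonneg_right hr (norm_nonneg _)
    have := h n
    push_cast
    linarith

lemma norm_le_sum_states (f : ℤ → ℂ) {c : ℤ} (hc : c ∈ ({1, -1, 0} : Finset ℤ)) :
    ‖f c‖ ≤ ∑ k ∈ ({1, -1, 0} : Finset ℤ), ‖f k‖ :=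
  Finset.single_le_sum (f := fun k => ‖f k‖) (fun _ _ => norm_nonneg _) hc

/-- The characteristic function of the normalized sum of the weights converges to a Gaussian. -/
lemma tendsto_carryMean_exp {q d : ℤ} (hq : 2 ≤ q) (hqd : -q < d) (hd : d ≤ 0) (α β : ℝ)
    (hv : 0 ≤ halfVar q d α β) :
    Tendsto (fun ℓ : ℕ => carryMean q d (weight q d α β) ℓ
      fun s _ => Complex.exp (Complex.I / (Real.sqrt ℓ : ℝ) * s)) atTop
      (𝓝 (Complex.exp (-(halfVar q d α β : ℝ)))) := by
  have hq1 : (1 : ℝ) < q := by exact_mod_cast hq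
  obtain ⟨κ, hκ⟩ := exists_second_corr hq1 d α β
  set G := weight q d α β with hG
  set h := weightCorr q d α β with hh
  set v := halfVar q d α β with hvdef
  set R : ℂ → ℤ → ℂ := fun z c =>
    transition q d (fun k => Complex.exp (z * G k) * approxEigen h κ z k) c
      - (1 + z ^ 2 * v) * approxEigen h κ z c with hR
  set ε : ℂ → ℝ := fun z => ∑ k ∈ ({1, -1, 0} : Finset ℤ), ‖R z k‖ with hε
  set δ : ℂ → ℝ := fun z => ∑ k ∈ ({1, -1, 0} : Finset ℤ), ‖1 - approxEigen h κ z k‖ with hδ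
  set z : ℕ → ℂ := fun n => Complex.I / (Real.sqrt n : ℝ) with hz
  have hz0 : Tendsto z atTop (𝓝 0) := by
    have h1 : Tendsto (fun n : ℕ => (Real.sqrt n)⁻¹) atTop (𝓝 0) :=
      tendsto_inv_atTop_zero.comp (Real.tendsto_sqrt_atTop.comp tendsto_natCast_atTop_atTop)
    have h2 := (Complex.continuous_ofReal.tendsto 0).comp h1
    have h3 := h2.const_mul Complex.I
    simpa [hz, div_eq_mul_inv, Function.comp_def] using h3
  have hzsq : ∀ n, z n ^ 2 = -1 / n := by
    intro n
    rw [hz]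
    simp only [div_pow, Complex.I_sq]
    rw [← Complex.ofReal_pow, Real.sq_sqrt (Nat.cast_nonneg n), Complex.ofReal_natCast]
  -- This scaling makes `n` errors of third order add up to `O(‖z n‖)`. At `n = 0` both sides
  -- vanish, since division by zero gives `z 0 = 0`.
  have hcube : ∀ n : ℕ, (n : ℂ) * z n ^ 3 = -z n := by
    intro n
    rcases eq_or_ne n 0 with rfl | hn
    · simp [hz]
    · have : (n : ℂ) ≠ 0 := by exact_mod_cast hn
      rw [pow_succ, hzsq]
      field_simp
  have hεO : ε =O[𝓝 0] fun z => z ^ 3 :=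
    IsBigO.fun_sum fun k _ => (isBigO_approxEigen (transition_weight hq1 d α β k) (hκ k)).norm_left
  have hε0 : Tendsto (fun n : ℕ => n * ε (z n)) atTop (𝓝 0) := by
    have h1 : (fun n : ℕ => (n : ℝ) * ε (z n)) =O[atTop] fun n => -z n := by
      have h2 := (isBigO_refl (fun n : ℕ => (n : ℝ)) atTop).mul (hεO.comp_tendsto hz0).norm_right
      refine (h2.trans ?_)
      refine IsBigO.of_bound 1 (Eventually.of_forall fun n => ?_)
      rw [← hcube n]
      simp
    exact h1.trans_tendsto (by simpa using hz0.neg)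
  have hδ0 : Tendsto (fun n => δ (z n)) atTop (𝓝 0) := by
    have hc : Continuous δ := by
      refine continuous_finsetSum _ fun k _ => ?_
      exact (continuous_const.sub (continuous_approxEigen h κ k)).norm
    have h1 := (hc.tendsto 0).comp hz0
    have h2 : δ 0 = 0 := by simp [hδ, approxEigen]
    rwa [h2] at h1
  have hmain : Tendsto (fun n => (1 + z n ^ 2 * v) ^ n * approxEigen h κ (z n) 0) atTop
      (𝓝 (Complex.exp (-v))) := by
    have h1 := Complex.tendsto_one_add_div_pow_exp (-v)
    have h2 := ((continuous_approxEigen h κ 0).tendsto 0).comp hz0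
    have h3 := h1.mul h2
    have h4 : approxEigen h κ 0 0 = 1 := by simp [approxEigen]
    rw [h4, mul_one] at h3
    refine h3.congr fun n => ?_
    simp only [Function.comp_apply]
    rw [hzsq]
    congr 3
    ring
  have hexp : ∀ (n : ℕ) (s : ℝ), ‖Complex.exp (z n * s)‖ = 1 := by
    intro n s
    have : z n * s = ((s / Real.sqrt n : ℝ) : ℂ) * Complex.I := by
      rw [hz]
      push_cast
      ring
    rw [this, Complex.norm_exp_ofReal_mul_I]
  -- The approximate eigenvalue is the real number `1 - v/n`; `v ≥ 0` keeps it at most `1`.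
  have hr : ∀ᶠ n : ℕ in atTop, ‖1 + z n ^ 2 * (v : ℂ)‖ ≤ 1 := by
    filter_upwards [tendsto_natCast_atTop_atTop.eventually_ge_atTop v,
      eventually_gt_atTop 0] with n hn hn0
    have hn0' : (0 : ℝ) < n := by exact_mod_cast hn0
    have h1 : 1 + z n ^ 2 * (v : ℂ) = ((1 - v / n : ℝ) : ℂ) := by
      rw [hzsq]
      push_cast
      ring
    have h2 : v / n ≤ 1 := (div_le_one hn0').2 hn
    have h3 : 0 ≤ v / n := by positivity
    rw [h1, Complex.norm_real, Real.norm_eq_abs, abs_le]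
    constructor <;> linarith
  refine (tendsto_iff_of_dist ?_).2 hmain
  have hsum := hδ0.add hε0
  rw [add_zero] at hsum
  refine squeeze_zero' (Eventually.of_forall fun _ => dist_nonneg) ?_ hsum
  filter_upwards [hr] with n hn
  -- With `n` fixed, the mean weighted by the approximate eigenvector nearly satisfies a geometric
  -- recursion in `j`. Removing the eigenvector at the end costs only `δ (z n)`.
  set a : ℕ → ℂ := fun j => carryMean q d G j fun s c =>
    Complex.exp (z n * s) * approxEigen h κ (z n) c with ha
  have ha0 : a 0 = approxEigen h κ (z n) 0 := by
    simp [ha, carryMean_zero]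
  have h1 : ‖a n - (1 + z n ^ 2 * (v : ℂ)) ^ n * a 0‖ ≤ n * ε (z n) := by
    refine norm_sub_pow_mul_le hn (fun j => ?_) n
    have : a (j + 1) - (1 + z n ^ 2 * (v : ℂ)) * a j
        = carryMean q d G j fun s c => Complex.exp (z n * s) * R (z n) c := by
      simp only [ha]
      rw [carryMean_succ hqd hd, ← carryMean_const_mul (𝕜 := ℂ), ← carryMean_sub]
      refine carryMean_congr fun s c _ => ?_
      simp only [hR, transition, Complex.ofReal_add, mul_add, Complex.exp_add, Complex.real_smul]
      ring
    rw [this]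
    refine norm_carryMean_le (by omega) fun s c hc => ?_
    rw [norm_mul, hexp, one_mul]
    exact norm_le_sum_states (R (z n)) hc
  have h2 : ‖carryMean q d G n (fun s _ => Complex.exp (z n * s)) - a n‖ ≤ δ (z n) := by
    simp only [ha]
    rw [← carryMean_sub]
    refine norm_carryMean_le (by omega) fun s c hc => ?_
    rw [← mul_one_sub, norm_mul, hexp, one_mul]
    exact norm_le_sum_states (fun k => 1 - approxEigen h κ (z n) k) hc
  rw [← ha0, dist_eq_norm]
  exact (norm_sub_le_norm_sub_add_norm_sub _ (a n) _).trans (add_le_add h2 h1)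

end CharacteristicFunction

/-! ### Positivity of the variances and of the covariance matrix. -/

section Positivity

/-- In the variables `x = -d` and `y = q + d - 1`, the absolute values of the extreme digits, all
coefficients are positive. The same substitution settles `varNeg_pos` and `det_covMat_pos`. -/
lemma varPos_pos {q d : ℝ} (hd : d ≤ 0) (hqd : 0 < q + d - 1) : 0 < varPos q d := by
  obtain ⟨x, rfl⟩ : ∃ x, d = -x := ⟨-d, by ring⟩
  obtain ⟨y, rfl⟩ : ∃ y, q = x + y + 1 := ⟨q - x - 1, by ring⟩
  have hx : 0 ≤ x := by linarith
  have hy : 0 < y := by linarith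
  have e : varPos (x + y + 1) (-x) = y ^ 2 * (2 * x ^ 4 + 8 * x ^ 3 * y + 4 * x ^ 3
      + 11 * x ^ 2 * y ^ 2 + 18 * x ^ 2 * y + 4 * x ^ 2 + 6 * x * y ^ 3 + 18 * x * y ^ 2
      + 14 * x * y + y ^ 4 + 4 * y ^ 3 + 4 * y ^ 2) / (4 * (x + y) ^ 5 * (x + y + 2)) := by
    rw [varPos]
    congr 1 <;> ring
  rw [e]
  positivity

lemma varNeg_pos {q d : ℝ} (hd : d < 0) (hqd : 0 ≤ q + d - 1) : 0 < varNeg q d := by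
  obtain ⟨x, rfl⟩ : ∃ x, d = -x := ⟨-d, by ring⟩
  obtain ⟨y, rfl⟩ : ∃ y, q = x + y + 1 := ⟨q - x - 1, by ring⟩
  have hx : 0 < x := by linarith
  have hy : 0 ≤ y := by linarith
  have e : varNeg (x + y + 1) (-x) = x ^ 2 * (x ^ 4 + 6 * x ^ 3 * y + 4 * x ^ 3
      + 11 * x ^ 2 * y ^ 2 + 18 * x ^ 2 * y + 4 * x ^ 2 + 8 * x * y ^ 3 + 18 * x * y ^ 2
      + 14 * x * y + 2 * y ^ 4 + 4 * y ^ 3 + 4 * y ^ 2) / (4 * (x + y) ^ 5 * (x + y + 2)) := by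
    rw [varNeg]
    congr 1 <;> ring
  rw [e]
  positivity

lemma det_covMat_pos {q d : ℝ} (hd : d < 0) (hqd : 0 < q + d - 1) :
    0 < varPos q d * varNeg q d - covConst q d ^ 2 := by
  obtain ⟨x, rfl⟩ : ∃ x, d = -x := ⟨-d, by ring⟩
  obtain ⟨y, rfl⟩ : ∃ y, q = x + y + 1 := ⟨q - x - 1, by ring⟩
  have hx : 0 < x := by linarith
  have hy : 0 < y := by linarith
  have e : varPos (x + y + 1) (-x) * varNeg (x + y + 1) (-x) - covConst (x + y + 1) (-x) ^ 2
      = (x * y * (x + y)) ^ 2 * (2 * x ^ 6 + 16 * x ^ 5 * y + 12 * x ^ 5 + 46 * x ^ 4 * y ^ 2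
        + 84 * x ^ 4 * y + 27 * x ^ 4 + 64 * x ^ 3 * y ^ 3 + 192 * x ^ 3 * y ^ 2
        + 168 * x ^ 3 * y + 30 * x ^ 3 + 46 * x ^ 2 * y ^ 4 + 192 * x ^ 2 * y ^ 3
        + 282 * x ^ 2 * y ^ 2 + 162 * x ^ 2 * y + 15 * x ^ 2 + 16 * x * y ^ 5
        + 84 * x * y ^ 4 + 168 * x * y ^ 3 + 162 * x * y ^ 2 + 66 * x * y + 2 * y ^ 6
        + 12 * y ^ 5 + 27 * y ^ 4 + 30 * y ^ 3 + 15 * y ^ 2)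
        / (4 * (x + y) ^ 5 * (x + y + 2)) ^ 2 := by
    rw [varPos, varNeg, covConst, show x + y + 1 - 1 = x + y by ring,
      show x + y + 1 + 1 = x + y + 2 by ring]
    have h1 : x + y ≠ 0 := by positivity
    have h2 : x + y + 2 ≠ 0 := by positivity
    field_simp
    ring
  rw [e]
  positivity

/-- Completing the square reduces this to the positivity of `v_1` and of the determinant. -/
lemma halfVar_nonneg {q d : ℝ} (hd : d < 0) (hqd : 0 < q + d - 1) (α β : ℝ) :
    0 ≤ halfVar q d α β := by
  have h1 := varPos_pos hd.le hqd
  have h2 := det_covMat_pos hd hqd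
  have : halfVar q d α β = ((varPos q d * α + covConst q d * β) ^ 2
      + (varPos q d * varNeg q d - covConst q d ^ 2) * β ^ 2) / (2 * varPos q d) := by
    rw [halfVar]
    field_simp
    ring
  rw [this]
  positivity

lemma dotProduct_covMat_mulVec (q d : ℝ) (x : Fin 2 → ℝ) :
    dotProduct x ((covMat q d).mulVec x) = 2 * halfVar q d (x 0) (x 1) := by
  simp only [dotProduct, Matrix.mulVec, Fin.sum_univ_two, covMat, halfVar, Matrix.of_apply,
    Matrix.cons_val', Matrix.cons_val_zero, Matrix.cons_val_one, Matrix.cons_val_fin_one]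
  ring

lemma posDef_covMat {q d : ℝ} (hd : d < 0) (hqd : 0 < q + d - 1) : (covMat q d).PosDef := by
  have h1 := varPos_pos hd.le hqd
  have h2 := det_covMat_pos hd hqd
  refine Matrix.posDef_iff_dotProduct_mulVec.2 ⟨?_, fun {x} hx => ?_⟩
  · ext i j
    fin_cases i <;> fin_cases j <;> simp [covMat]
  · rw [star_trivial, dotProduct_covMat_mulVec]
    have : 2 * halfVar q d (x 0) (x 1) = ((varPos q d * x 0 + covConst q d * x 1) ^ 2
        + (varPos q d * varNeg q d - covConst q d ^ 2) * x 1 ^ 2) / varPos q d := by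
      rw [halfVar]
      field_simp
      ring
    rw [this]
    refine div_pos ?_ h1
    by_cases h : x 1 = 0
    · have h0 : x 0 ≠ 0 := by
        intro h0
        apply hx
        ext i
        fin_cases i <;> simp [h0, h]
      rw [h]
      have : 0 < (varPos q d * x 0) ^ 2 := by positivity
      simpa using this
    · positivity

end Positivity

/-! ### From the counts and random variables to means over the chain. -/

section Bridge

variable {q d : ℤ}

/-- The counts of the two kinds of carries expressed by a sum of weights. -/
lemma carryCount_linear (α β : ℝ) {ℓ : ℕ} (x y : QDExpansion q d ℓ) :
    α * (carryCount q d 1 x y - meanPos q d * ℓ) + β * (carryCount q d (-1) x y - meanNeg q d * ℓ)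
      = carrySum q d (weight q d α β) x y := by
  have hw : ∀ k ∈ ({1, -1, 0} : Finset ℤ), weight q d α β k
      = α * (if k = 1 then 1 else 0) + β * (if k = -1 then 1 else 0)
        - (α * meanPos q d + β * meanNeg q d) := by
    intro k hk
    have hk' : k = 1 ∨ k = -1 ∨ k = 0 := by simpa using hk
    obtain rfl | rfl | rfl := hk' <;> simp [weight, quad] <;> ring
  rw [carrySum, Finset.sum_congr rfl fun j _ => hw _ (carry_mem q d _ (j + 1))]
  simp only [carryCount, Finset.sum_sub_distrib, Finset.sum_add_distrib, ← Finset.mul_sum,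
    Finset.sum_boole, Finset.sum_const, Finset.card_range, nsmul_eq_mul]
  ring

lemma carry_nonneg_of_eq_zero (hd : d = 0) {ℓ : ℕ} (x y : QDExpansion q d ℓ)
    (j : ℕ) : 0 ≤ carry q d (digitSum x y) j := by
  subst hd
  have hs : ∀ j, 0 ≤ digitSum x y j := by
    intro j
    unfold digitSum
    split_ifs with h
    · exact add_nonneg (x ⟨j, h⟩).2.1 (y ⟨j, h⟩).2.1
    · exact le_rfl
  induction j with
  | zero => exact le_rfl
  | succ j ih =>
    rw [carry_succ, nextCarry]
    have := hs j
    split_ifs <;> omega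

lemma carry_nonpos_of_eq (hd : d = -q + 1) {ℓ : ℕ} (x y : QDExpansion q d ℓ)
    (j : ℕ) : carry q d (digitSum x y) j ≤ 0 := by
  have hs : ∀ j, digitSum x y j ≤ 0 := by
    intro j
    unfold digitSum
    split_ifs with h
    · have h1 := (x ⟨j, h⟩).2.2
      have h2 := (y ⟨j, h⟩).2.2
      omega
    · exact le_rfl
  induction j with
  | zero => exact le_rfl
  | succ j ih =>
    rw [carry_succ, nextCarry]
    have := hs j
    split_ifs <;> omega

lemma carryCount_neg_one_eq_zero (hd : d = 0) {ℓ : ℕ} (x y : QDExpansion q d ℓ) :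
    carryCount q d (-1) x y = 0 := by
  rw [carryCount, Finset.card_eq_zero, Finset.filter_eq_empty_iff]
  intro j _ h
  have := carry_nonneg_of_eq_zero hd x y (j + 1)
  omega

lemma carryCount_one_eq_zero (hd : d = -q + 1) {ℓ : ℕ} (x y : QDExpansion q d ℓ) :
    carryCount q d 1 x y = 0 := by
  rw [carryCount, Finset.card_eq_zero, Finset.filter_eq_empty_iff]
  intro j _ h
  have := carry_nonpos_of_eq hd x y (j + 1)
  omega

variable {Ω : Type*} [MeasurableSpace Ω] {P : Measure Ω} [IsProbabilityMeasure P] {ℓ : ℕ}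
  {X Y : Ω → QDExpansion q d ℓ}

lemma measurable_pair {E : Type*} [MeasurableSpace E] (hXm : Measurable X) (hYm : Measurable Y)
    (F : QDExpansion q d ℓ → QDExpansion q d ℓ → E) : Measurable fun ω => F (X ω) (Y ω) :=
  (measurable_of_countable fun p : QDExpansion q d ℓ × QDExpansion q d ℓ => F p.1 p.2).comp
    (hXm.prodMk hYm)

lemma memLp_pair (hXm : Measurable X) (hYm : Measurable Y)
    (F : QDExpansion q d ℓ → QDExpansion q d ℓ → ℝ) : MemLp (fun ω => F (X ω) (Y ω)) 2 P := by
  refine MemLp.of_bound (measurable_pair hXm hYm F).aestronglyMeasurable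
    (∑ p : QDExpansion q d ℓ × QDExpansion q d ℓ, ‖F p.1 p.2‖) (Eventually.of_forall fun ω => ?_)
  exact Finset.single_le_sum (f := fun p : QDExpansion q d ℓ × QDExpansion q d ℓ => ‖F p.1 p.2‖)
    (fun _ _ => norm_nonneg _) (Finset.mem_univ (X ω, Y ω))

lemma integral_pair {E : Type*} [NormedAddCommGroup E] [NormedSpace ℝ E] [CompleteSpace E]
    [MeasurableSpace E] [BorelSpace E] [SecondCountableTopology E]
    (hq : 0 < q) (hXm : Measurable X) (hYm : Measurable Y)
    (hX : P.map X = uniformOn Set.univ) (hY : P.map Y = uniformOn Set.univ)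
    (hXY : IndepFun X Y P) (F : QDExpansion q d ℓ → QDExpansion q d ℓ → E) :
    ∫ ω, F (X ω) (Y ω) ∂P = pairMean q d F := by
  have hmap := (indepFun_iff_map_prod_eq_prod_map_map hXm.aemeasurable hYm.aemeasurable).1 hXY
  have hF : Measurable fun p : QDExpansion q d ℓ × QDExpansion q d ℓ => F p.1 p.2 :=
    measurable_of_countable _
  have hne : Nonempty (QDExpansion q d ℓ) := ⟨fun _ => ⟨d, le_rfl, by omega⟩⟩
  have h1 : ∫ ω, F (X ω) (Y ω) ∂P
      = ∫ p, F p.1 p.2 ∂(P.map fun ω => (X ω, Y ω)) :=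
    (integral_map (hXm.prodMk hYm).aemeasurable hF.aestronglyMeasurable).symm
  have hs : ∀ x : QDExpansion q d ℓ,
      (uniformOn (Set.univ : Set (QDExpansion q d ℓ))).real {x} = ((q : ℝ) ^ ℓ)⁻¹ := by
    intro x
    rw [measureReal_def, uniformOn_univ, Measure.count_singleton, ENNReal.toReal_div,
      ENNReal.toReal_one, ENNReal.toReal_natCast, card_expansion hq, one_div]
  rw [h1, hmap, hX, hY, integral_fintype .of_finite, pairMean, Fintype.sum_prod_type,
    Finset.smul_sum]
  refine Finset.sum_congr rfl fun x _ => ?_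
  rw [Finset.smul_sum]
  refine Finset.sum_congr rfl fun y _ => ?_
  rw [← Set.singleton_prod_singleton, measureReal_prod_prod, hs, hs, ← mul_inv, ← pow_add,
    two_mul]

end Bridge

/-! ### Convergence in distribution from characteristic functions. -/

section Convergence

open scoped RealInnerProductSpace Topology

/-- Lévy's continuity theorem for random variables on varying probability spaces. -/
lemma tendstoInDistribution_of_tendsto_integral_exp {E : Type*} [NormedAddCommGroup E]
    [InnerProductSpace ℝ E] [FiniteDimensional ℝ E] [MeasurableSpace E] [BorelSpace E]
    {Ω : ℕ → Type*} [∀ n, MeasurableSpace (Ω n)] (P : ∀ n, Measure (Ω n))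
    [∀ n, IsProbabilityMeasure (P n)] (μ : Measure E) [IsProbabilityMeasure μ]
    {Z : ∀ n, Ω n → E} (hZ : ∀ n, Measurable (Z n))
    (h : ∀ t, Tendsto (fun n => ∫ ω, Complex.exp (⟪Z n ω, t⟫ * Complex.I) ∂(P n)) atTop
      (𝓝 (charFun μ t))) :
    TendstoInDistribution Z atTop id P μ where
  forall_aemeasurable n := (hZ n).aemeasurable
  tendsto := by
    refine ProbabilityMeasure.tendsto_iff_tendsto_charFun.2 fun t => ?_
    simp only [ProbabilityMeasure.coe_mk, Measure.map_id]
    refine (h t).congr fun n => ?_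
    rw [charFun_apply, integral_map (hZ n).aemeasurable]
    exact (Measurable.aestronglyMeasurable (by fun_prop))

end Convergence

/-! ### Asymptotics of linear combinations of the two counts. -/

section Asymptotics

open scoped Topology

/-- The mean of a centered
linear combination of the two counts is bounded. -/
lemma isBigO_integral {q d : ℤ} (hq : 2 ≤ q) (hqd : -q < d) (hd : d ≤ 0)
    {Ω : ℕ → Type*} [∀ ℓ, MeasurableSpace (Ω ℓ)]
    (P : ∀ ℓ, Measure (Ω ℓ)) [∀ ℓ, IsProbabilityMeasure (P ℓ)]
    (X Y : ∀ ℓ, Ω ℓ → QDExpansion q d ℓ)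
    (hXm : ∀ ℓ, Measurable (X ℓ)) (hYm : ∀ ℓ, Measurable (Y ℓ))
    (hX : ∀ ℓ, (P ℓ).map (X ℓ) = uniformOn Set.univ)
    (hY : ∀ ℓ, (P ℓ).map (Y ℓ) = uniformOn Set.univ)
    (hXY : ∀ ℓ, IndepFun (X ℓ) (Y ℓ) (P ℓ)) (α β : ℝ) :
    (fun ℓ : ℕ => ∫ ω, (α * (carryCount q d 1 (X ℓ ω) (Y ℓ ω) - meanPos q d * ℓ)
      + β * (carryCount q d (-1) (X ℓ ω) (Y ℓ ω) - meanNeg q d * ℓ)) ∂(P ℓ))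
      =O[atTop] fun _ => (1 : ℝ) := by
  obtain ⟨C, -, h⟩ := exists_bound_mean hq hqd hd α β
  refine IsBigO.of_bound C (Eventually.of_forall fun ℓ => ?_)
  simp only [carryCount_linear]
  rw [integral_pair (by omega) (hXm ℓ) (hYm ℓ) (hX ℓ) (hY ℓ) (hXY ℓ)
    fun x y => carrySum q d (weight q d α β) x y]
  simpa [carryMean] using h ℓ

/-- The variance of a linear combination of the two counts grows linearly. -/
lemma isBigO_variance {q d : ℤ} (hq : 2 ≤ q) (hqd : -q < d) (hd : d ≤ 0)
    {Ω : ℕ → Type*} [∀ ℓ, MeasurableSpace (Ω ℓ)]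
    (P : ∀ ℓ, Measure (Ω ℓ)) [∀ ℓ, IsProbabilityMeasure (P ℓ)]
    (X Y : ∀ ℓ, Ω ℓ → QDExpansion q d ℓ)
    (hXm : ∀ ℓ, Measurable (X ℓ)) (hYm : ∀ ℓ, Measurable (Y ℓ))
    (hX : ∀ ℓ, (P ℓ).map (X ℓ) = uniformOn Set.univ)
    (hY : ∀ ℓ, (P ℓ).map (Y ℓ) = uniformOn Set.univ)
    (hXY : ∀ ℓ, IndepFun (X ℓ) (Y ℓ) (P ℓ)) (α β : ℝ) :
    (fun ℓ : ℕ => variance (fun ω => α * (carryCount q d 1 (X ℓ ω) (Y ℓ ω) : ℝ)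
      + β * (carryCount q d (-1) (X ℓ ω) (Y ℓ ω) : ℝ)) (P ℓ) - 2 * halfVar q d α β * ℓ)
      =O[atTop] fun _ => (1 : ℝ) := by
  obtain ⟨C₁, hC₁, h₁⟩ := exists_bound_mean hq hqd hd α β
  obtain ⟨C₂, -, h₂⟩ := exists_bound_second_moment hq hqd hd α β
  refine IsBigO.of_bound (C₂ + C₁ ^ 2) (Eventually.of_forall fun ℓ => ?_)
  set G := weight q d α β with hG
  have e : (fun ω => α * (carryCount q d 1 (X ℓ ω) (Y ℓ ω) : ℝ)
      + β * (carryCount q d (-1) (X ℓ ω) (Y ℓ ω) : ℝ))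
      = fun ω => carrySum q d G (X ℓ ω) (Y ℓ ω) + (α * meanPos q d + β * meanNeg q d) * ℓ := by
    ext ω
    rw [← carryCount_linear]
    ring
  have hm : MemLp (fun ω => carrySum q d G (X ℓ ω) (Y ℓ ω)) 2 (P ℓ) :=
    memLp_pair (hXm ℓ) (hYm ℓ) fun x y => carrySum q d G x y
  rw [e, variance_add_const hm.aestronglyMeasurable, variance_eq_sub hm]
  simp only [Pi.pow_apply]
  rw [integral_pair (by omega) (hXm ℓ) (hYm ℓ) (hX ℓ) (hY ℓ) (hXY ℓ)
    fun x y => carrySum q d G x y ^ 2, integral_pair (by omega) (hXm ℓ) (hYm ℓ) (hX ℓ) (hY ℓ)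
    (hXY ℓ) fun x y => carrySum q d G x y]
  have a₁ : |pairMean q d fun x y : QDExpansion q d ℓ => carrySum q d G x y| ≤ C₁ := h₁ ℓ
  have a₂ : |(pairMean q d fun x y : QDExpansion q d ℓ => carrySum q d G x y ^ 2)
    - 2 * halfVar q d α β * ℓ| ≤ C₂ := h₂ ℓ
  have a₃ := sq_le_sq' (abs_le.1 a₁).1 (abs_le.1 a₁).2
  have a₄ := sq_nonneg (pairMean q d fun x y : QDExpansion q d ℓ => carrySum q d G x y)
  rw [norm_one, mul_one, Real.norm_eq_abs, abs_le]
  have a₅ := abs_le.1 a₂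
  constructor <;> linarith [a₅.1, a₅.2, sq_nonneg C₁]

/-- Convergence of the joint characteristic function of the normalized counts. -/
lemma tendsto_integral_exp {q d : ℤ} (hq : 2 ≤ q) (hqd : -q < d) (hd : d ≤ 0)
    {Ω : ℕ → Type*} [∀ ℓ, MeasurableSpace (Ω ℓ)]
    (P : ∀ ℓ, Measure (Ω ℓ)) [∀ ℓ, IsProbabilityMeasure (P ℓ)]
    (X Y : ∀ ℓ, Ω ℓ → QDExpansion q d ℓ)
    (hXm : ∀ ℓ, Measurable (X ℓ)) (hYm : ∀ ℓ, Measurable (Y ℓ))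
    (hX : ∀ ℓ, (P ℓ).map (X ℓ) = uniformOn Set.univ)
    (hY : ∀ ℓ, (P ℓ).map (Y ℓ) = uniformOn Set.univ)
    (hXY : ∀ ℓ, IndepFun (X ℓ) (Y ℓ) (P ℓ)) (α β : ℝ)
    (hv : 0 ≤ halfVar q d α β) :
    Tendsto (fun ℓ : ℕ => ∫ ω, Complex.exp (((α * (carryCount q d 1 (X ℓ ω) (Y ℓ ω)
      - meanPos q d * ℓ) + β * (carryCount q d (-1) (X ℓ ω) (Y ℓ ω) - meanNeg q d * ℓ))
        / Real.sqrt ℓ : ℝ) * Complex.I) ∂(P ℓ))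
      atTop (𝓝 (Complex.exp (-(halfVar q d α β : ℝ)))) := by
  refine (tendsto_carryMean_exp hq hqd hd α β hv).congr fun ℓ => ?_
  simp only [carryCount_linear]
  rw [integral_pair (by omega) (hXm ℓ) (hYm ℓ) (hX ℓ) (hY ℓ) (hXY ℓ)
    fun x y => Complex.exp ((carrySum q d (weight q d α β) x y / Real.sqrt ℓ : ℝ) * Complex.I),
    carryMean]
  congr 1
  ext x y
  congr 1
  push_cast
  ring

end Asymptotics

end QDExpansion

theorem mainTheorem1 (q d : ℤ) (hq : 2 ≤ q) (hqd : -q < d) (hd : d ≤ 0)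
    {Ω : ℕ → Type*} [∀ ℓ, MeasurableSpace (Ω ℓ)]
    (P : ∀ ℓ, Measure (Ω ℓ)) [∀ ℓ, IsProbabilityMeasure (P ℓ)]
    (X Y : ∀ ℓ, Ω ℓ → QDExpansion q d ℓ)
    (hXm : ∀ ℓ, Measurable (X ℓ)) (hYm : ∀ ℓ, Measurable (Y ℓ))
    (hX : ∀ ℓ, (P ℓ).map (X ℓ) = uniformOn Set.univ)
    (hY : ∀ ℓ, (P ℓ).map (Y ℓ) = uniformOn Set.univ)
    (hXY : ∀ ℓ, IndepFun (X ℓ) (Y ℓ) (P ℓ))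
    (M N : ∀ ℓ, Ω ℓ → ℝ)
    (hM : ∀ ℓ ω, M ℓ ω = (QDExpansion.carryCount q d 1 (X ℓ ω) (Y ℓ ω) : ℝ))
    (hN : ∀ ℓ ω, N ℓ ω = (QDExpansion.carryCount q d (-1) (X ℓ ω) (Y ℓ ω) : ℝ)) :
    ((fun ℓ : ℕ => (∫ ω, M ℓ ω ∂(P ℓ)) - QDExpansion.meanPos q d * (ℓ : ℝ))
        =O[atTop] fun _ => (1 : ℝ)) ∧
    ((fun ℓ : ℕ => (∫ ω, N ℓ ω ∂(P ℓ)) - QDExpansion.meanNeg q d * (ℓ : ℝ))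
        =O[atTop] fun _ => (1 : ℝ)) ∧
    ((fun ℓ : ℕ => variance (M ℓ) (P ℓ) - QDExpansion.varPos q d * (ℓ : ℝ))
        =O[atTop] fun _ => (1 : ℝ)) ∧
    ((fun ℓ : ℕ => variance (N ℓ) (P ℓ) - QDExpansion.varNeg q d * (ℓ : ℝ))
        =O[atTop] fun _ => (1 : ℝ)) ∧
    ((fun ℓ : ℕ => covariance (M ℓ) (N ℓ) (P ℓ) - QDExpansion.covConst q d * (ℓ : ℝ))
        =O[atTop] fun _ => (1 : ℝ)) ∧
    (d ≠ 0 → d ≠ -q + 1 →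
      (QDExpansion.covMat q d).PosDef ∧
      TendstoInDistribution
        (fun (ℓ : ℕ) (ω : Ω ℓ) =>
          (!₂[(M ℓ ω - QDExpansion.meanPos q d * (ℓ : ℝ)) / Real.sqrt ℓ,
              (N ℓ ω - QDExpansion.meanNeg q d * (ℓ : ℝ)) / Real.sqrt ℓ] :
            EuclideanSpace ℝ (Fin 2)))
        atTop id P (multivariateGaussian 0 (QDExpansion.covMat q d))) ∧
    (d = 0 →
      (∀ ℓ ω, N ℓ ω = 0) ∧ 0 < QDExpansion.varPos q d ∧
      TendstoInDistribution
        (fun (ℓ : ℕ) (ω : Ω ℓ) => (M ℓ ω - QDExpansion.meanPos q d * (ℓ : ℝ)) / Real.sqrt ℓ)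
        atTop id P (gaussianReal 0 (QDExpansion.varPos q d).toNNReal)) ∧
    (d = -q + 1 →
      (∀ ℓ ω, M ℓ ω = 0) ∧ 0 < QDExpansion.varNeg q d ∧
      TendstoInDistribution
        (fun (ℓ : ℕ) (ω : Ω ℓ) => (N ℓ ω - QDExpansion.meanNeg q d * (ℓ : ℝ)) / Real.sqrt ℓ)
        atTop id P (gaussianReal 0 (QDExpansion.varNeg q d).toNNReal)) := by
  have hqr : (1 : ℝ) < q := by exact_mod_cast hq
  obtain rfl : M = fun ℓ ω => (QDExpansion.carryCount q d 1 (X ℓ ω) (Y ℓ ω) : ℝ) := by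
    ext ℓ ω; exact hM ℓ ω
  obtain rfl : N = fun ℓ ω => (QDExpansion.carryCount q d (-1) (X ℓ ω) (Y ℓ ω) : ℝ) := by
    ext ℓ ω; exact hN ℓ ω
  have hmean := fun α β => QDExpansion.isBigO_integral hq hqd hd P X Y hXm hYm hX hY hXY α β
  have hvar := fun α β => QDExpansion.isBigO_variance hq hqd hd P X Y hXm hYm hX hY hXY α β
  have hexp := fun α β => QDExpansion.tendsto_integral_exp hq hqd hd P X Y hXm hYm hX hY hXY α β
  have hMm : ∀ ℓ, MemLp (fun ω => (QDExpansion.carryCount q d 1 (X ℓ ω) (Y ℓ ω) : ℝ)) 2 (P ℓ) :=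
    fun ℓ => QDExpansion.memLp_pair (hXm ℓ) (hYm ℓ)
      fun x y => (QDExpansion.carryCount q d 1 x y : ℝ)
  have hNm : ∀ ℓ, MemLp (fun ω => (QDExpansion.carryCount q d (-1) (X ℓ ω) (Y ℓ ω) : ℝ)) 2 (P ℓ) :=
    fun ℓ => QDExpansion.memLp_pair (hXm ℓ) (hYm ℓ)
      fun x y => (QDExpansion.carryCount q d (-1) x y : ℝ)
  have hVM := hvar 1 0
  have hVN := hvar 0 1
  have hVS := hvar 1 1
  simp only [QDExpansion.halfVar, one_mul, zero_mul, add_zero, zero_add] at hVM hVN hVS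
  refine ⟨?_, ?_, ?_, ?_, ?_, ?_, ?_, ?_⟩
  · refine (hmean 1 0).congr_left fun ℓ => ?_
    simp only [one_mul, zero_mul, add_zero]
    rw [integral_sub ((hMm ℓ).integrable (by norm_num)) (integrable_const _)]
    simp
  · refine (hmean 0 1).congr_left fun ℓ => ?_
    simp only [one_mul, zero_mul, zero_add]
    rw [integral_sub ((hNm ℓ).integrable (by norm_num)) (integrable_const _)]
    simp
  · refine hVM.congr_left fun ℓ => ?_
    ring
  · refine hVN.congr_left fun ℓ => ?_
    ring
  -- Polarization: the covariance is half of `Var(M + N) - Var M - Var N`.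
  · refine (((hVS.sub hVM).sub hVN).const_mul_left (1 / 2)).congr_left fun ℓ => ?_
    rw [variance_fun_add (hMm ℓ) (hNm ℓ)]
    ring
  · intro hd0 hd1
    have hdr : (d : ℝ) < 0 := by
      have : d < 0 := by omega
      exact_mod_cast this
    have her : (0 : ℝ) < q + d - 1 := by
      have : 0 < q + d - 1 := by omega
      exact_mod_cast this
    have hpd := QDExpansion.posDef_covMat hdr her
    refine ⟨hpd, QDExpansion.tendstoInDistribution_of_tendsto_integral_exp _ _ (fun ℓ => ?_)
      fun t => ?_⟩
    · exact QDExpansion.measurable_pair (hXm ℓ) (hYm ℓ) fun x y =>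
        (!₂[((QDExpansion.carryCount q d 1 x y : ℝ) - QDExpansion.meanPos q d * (ℓ : ℝ))
            / Real.sqrt ℓ,
          ((QDExpansion.carryCount q d (-1) x y : ℝ) - QDExpansion.meanNeg q d * (ℓ : ℝ))
            / Real.sqrt ℓ] : EuclideanSpace ℝ (Fin 2))
    · rw [charFun_multivariateGaussian hpd.posSemidef]
      -- The coordinates of the frequency `t` serve as the weights `α, β`, so the one-dimensional
      -- limit gives the joint characteristic function.
      have h := hexp (t 0) (t 1) (QDExpansion.halfVar_nonneg hdr her _ _)
      rw [QDExpansion.dotProduct_covMat_mulVec]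
      convert h using 3 with ℓ
      · ext ω
        congr 1
        simp only [PiLp.inner_apply, Fin.sum_univ_two, RCLike.inner_apply, conj_trivial]
        simp
        ring
      · simp
  · intro hd0
    have hv := QDExpansion.varPos_pos (q := q) (d := d) (by simp [hd0])
      (by rw [hd0]; push_cast; linarith)
    refine ⟨fun ℓ ω => ?_, hv, QDExpansion.tendstoInDistribution_of_tendsto_integral_exp _ _
      (fun ℓ => ?_) fun t => ?_⟩
    · simp [QDExpansion.carryCount_neg_one_eq_zero hd0]
    · exact QDExpansion.measurable_pair (hXm ℓ) (hYm ℓ) fun x y =>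
        ((QDExpansion.carryCount q d 1 x y : ℝ) - QDExpansion.meanPos q d * (ℓ : ℝ))
          / Real.sqrt ℓ
    · rw [charFun_gaussianReal]
      -- Here the other count vanishes identically, so only one weight is needed, and nonnegativity
      -- of the form comes from `v_1 > 0` alone.
      have h := hexp t 0 (by
        rw [QDExpansion.halfVar]
        linarith [mul_nonneg (sq_nonneg t) hv.le])
      convert h using 3 with ℓ
      · ext ω
        congr 1
        simp
        ring
      · rw [Real.coe_toNNReal _ hv.le, QDExpansion.halfVar]
        push_cast
        ring
  · intro hd1
    have hdr : (d : ℝ) < 0 := by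
      have : d < 0 := by omega
      exact_mod_cast this
    have hv := QDExpansion.varNeg_pos (q := q) hdr (by rw [hd1]; push_cast; linarith)
    refine ⟨fun ℓ ω => ?_, hv, QDExpansion.tendstoInDistribution_of_tendsto_integral_exp _ _
      (fun ℓ => ?_) fun t => ?_⟩
    · simp [QDExpansion.carryCount_one_eq_zero hd1]
    · exact QDExpansion.measurable_pair (hXm ℓ) (hYm ℓ) fun x y =>
        ((QDExpansion.carryCount q d (-1) x y : ℝ) - QDExpansion.meanNeg q d * (ℓ : ℝ))
          / Real.sqrt ℓ
    · rw [charFun_gaussianReal]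
      have h := hexp 0 t (by
        rw [QDExpansion.halfVar]
        linarith [mul_nonneg (sq_nonneg t) hv.le])
      convert h using 3 with ℓ
      · ext ω
        congr 1
        simp
        ring
      · rw [Real.coe_toNNReal _ hv.le, QDExpansion.halfVar]
        push_cast
        ring
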